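/- Let $a<0<b$ and let $g$ be a real function that is real-analytic on (a neighbourhood of) the interval $[a,b]$, with $g(0)=0$ and $g'(0)=1$. Let $G(x)=\int_0^x g(\xi)\,d\xi$, and suppose that, for some real $c$, one has $G(a)=G(b)=c$, $G(x)<c$ for all $a<x<b$, and $x\,g(x)>0$ for all $a<x<b$ with $x\neq 0$. The equilibrium $0=(0,0)$ of the planar system $\dot x=y,\ \dot y=-g(x)$, which is equivalent to the scalar equation $$\ddot x+g(x)=0,\qquad (1)$$ is called an isochronous center if there is $T>0$ such that the orbit through each point of some punctured neighbourhood of $(0,0)$ is closed, with minimal period $T$. Then equation (1) has an isochronous center at $0$ if and only if there is a real function $F$, analytic in a neighbourhood of $0$, such that $$2G(x)-x\,g(x)=g(x)\,F(G(x))$$ for all $x$ in some neighbourhood of $0$. -/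

import Mathlib

open Filter Topology

/-- The potential `G(x) = ∫₀ˣ g(ξ) dξ` of the scalar equation `x'' + g(x) = 0`. -/
noncomputable def potential (g : ℝ → ℝ) (x : ℝ) : ℝ := ∫ ξ in (0 : ℝ)..x, g ξ

/-- Hypothesis `(H)` with turning points `a`, `b` and energy `c`. -/
structure HypothesisH (g : ℝ → ℝ) (a b c : ℝ) : Prop where
  a_neg : a < 0
  b_pos : 0 < b
  potential_a : potential g a = c
  potential_b : potential g b = c
  potential_lt : ∀ x, a < x → x < b → potential g x < c
  mul_pos : ∀ x, a < x → x < b → x ≠ 0 → 0 < x * g x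

/-- The vector field of the planar system `x' = y`, `y' = -g(x)` equivalent to `x'' + g(x) = 0`. -/
def planarField (g : ℝ → ℝ) (p : ℝ × ℝ) : ℝ × ℝ := (p.2, -g p.1)

/-- `T` is the minimal (positive) period of `γ`; a constant `γ` has no minimal period. -/
def IsMinimalPeriod (γ : ℝ → ℝ × ℝ) (T : ℝ) : Prop :=
  IsLeast {τ : ℝ | 0 < τ ∧ Function.Periodic γ τ} T

/-- `p` is an isochronous center of `X`: it is an equilibrium with a punctured neighbourhood
filled with closed orbits, all of which have one and the same minimal period. -/
def IsIsochronousCenter (X : ℝ × ℝ → ℝ × ℝ) (p : ℝ × ℝ) : Prop :=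
  X p = 0 ∧ ∃ T : ℝ, ∀ᶠ q in 𝓝[≠] p, ∃ γ : ℝ → ℝ × ℝ,
    IsIntegralCurve γ (fun _ => X) ∧ γ 0 = q ∧ IsMinimalPeriod γ T

/-! An analytic chart x = X(u) with X'(0) = 1 brings G to u²/2, so that g(X) X' = u and small orbits
become circles u = r sin θ, y = r cos θ with θ' = 1/X'(u). The period is therefore ∫ X'(r sin s) ds
over [0, 2π] (`orbitPeriod`), which sees only the even part of X'. If it is constant in r, a mean
value argument and isolation of zeros force X'(u) + X'(-u) = 2; conversely this gives period 2π. On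
the other side, multiplying the equation for F at x = X(u) by X' and cancelling u turns it into u X'
- X = F(u²/2). Such an analytic F exists iff u X' - X is even. With D(u) = X(u) - X(-u), that
evenness reads u D' = D, which for analytic D means D' is constant: the same condition as before. -/

/-! ### Power series with real coefficients -/

theorem eventually_abs_lt_of_pos {ρ : ℝ} (hρ : 0 < ρ) : ∀ᶠ x in 𝓝 (0 : ℝ), |x| < ρ := by
  filter_upwards [Metric.ball_mem_nhds (0 : ℝ) hρ] with x hx
  simpa using hx

theorem AnalyticAt.exists_real_coeff {f : ℝ → ℝ} (hf : AnalyticAt ℝ f 0) :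
    ∃ (c : ℕ → ℝ) (ρ C : ℝ), 0 < ρ ∧ (∀ n, |c n| * ρ ^ n ≤ C) ∧
      (∀ x, |x| < ρ → HasSum (fun n => c n * x ^ n) (f x)) ∧ c 0 = f 0 ∧ c 1 = deriv f 0 := by
  obtain ⟨p, R, hp⟩ := hf
  obtain ⟨ρ, hρ0, hρR⟩ := ENNReal.lt_iff_exists_nnreal_btwn.1 hp.r_pos
  obtain ⟨C, -, hC⟩ := p.norm_mul_pow_le_of_lt_radius (hρR.trans_le hp.r_le)
  refine ⟨p.coeff, ρ, C, by exact_mod_cast hρ0, fun n => ?_, fun x hx => ?_, ?_, ?_⟩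
  · simpa [FormalMultilinearSeries.norm_apply_eq_norm_coef] using hC n
  · have hx' : x ∈ Metric.eball (0 : ℝ) R := by
      refine Metric.eball_subset_eball hρR.le ?_
      rw [Metric.eball_coe]
      simpa using hx
    have := hp.hasSum hx'
    simpa [FormalMultilinearSeries.apply_eq_pow_smul_coeff, mul_comm] using this
  · exact hp.coeff_zero 1
  · rw [hp.hasFPowerSeriesAt.deriv]
    rfl

theorem exists_analyticAt_hasSum {c : ℕ → ℝ} {ρ C : ℝ} (hρ : 0 < ρ)
    (hc : ∀ n, |c n| * ρ ^ n ≤ C) :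
    ∃ f : ℝ → ℝ, AnalyticAt ℝ f 0 ∧ ∀ x, |x| < ρ → HasSum (fun n => c n * x ^ n) (f x) := by
  set p := FormalMultilinearSeries.ofScalars ℝ c with hp
  have hr : ENNReal.ofReal ρ ≤ p.radius := by
    refine p.le_radius_of_bound (r := ρ.toNNReal) C fun n => ?_
    rw [hp, FormalMultilinearSeries.ofScalars_norm, Real.coe_toNNReal _ hρ.le]
    exact hc n
  have hpos : 0 < p.radius := lt_of_lt_of_le (by simpa using hρ) hr
  have hs := p.hasFPowerSeriesOnBall hpos
  refine ⟨p.sum, hs.analyticAt, fun x hx => ?_⟩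
  have hx' : x ∈ Metric.eball (0 : ℝ) p.radius := by
    refine Metric.eball_subset_eball hr ?_
    rw [Metric.eball_ofReal]
    simpa using hx
  have := hs.hasSum hx'
  simpa [hp, FormalMultilinearSeries.ofScalars_apply_eq, mul_comm] using this

theorem exists_potential_eq_sq_mul {g : ℝ → ℝ} (hg : AnalyticAt ℝ g 0) (hg0 : g 0 = 0) :
    ∃ h : ℝ → ℝ, AnalyticAt ℝ h 0 ∧ h 0 = deriv g 0 / 2 ∧
      ∀ᶠ x in 𝓝 (0 : ℝ), potential g x = x ^ 2 * h x := by
  obtain ⟨c, ρ, C, hρ, hC, hs, hc0, hc1⟩ := hg.exists_real_coeff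
  have hd : ∀ n, |c (n + 1) / (n + 2)| * ρ ^ n ≤ C / ρ := fun n => by
    rw [le_div_iff₀ hρ, mul_assoc, ← pow_succ]
    refine le_trans ?_ (hC (n + 1))
    refine mul_le_mul_of_nonneg_right ?_ (by positivity)
    have h2 : (1 : ℝ) ≤ n + 2 := by linarith [(n.cast_nonneg : (0 : ℝ) ≤ n)]
    rw [abs_div, abs_of_pos (by linarith : (0 : ℝ) < n + 2)]
    exact div_le_self (abs_nonneg _) h2
  obtain ⟨h, hh, hhs⟩ := exists_analyticAt_hasSum hρ hd
  refine ⟨h, hh, ?_, ?_⟩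
  · have := (hhs 0 (by simpa using hρ)).unique (hasSum_single 0 fun n hn => by simp [hn])
    simpa [hc1] using this
  · have hball := eventually_abs_lt_of_pos hρ
    filter_upwards [hball] with x hx
    have hint : HasSum (fun n => ∫ ξ in (0 : ℝ)..x, c n * ξ ^ n) (potential g x) := by
      refine intervalIntegral.hasSum_integral_of_dominated_convergence
        (fun n _ => |c n| * |x| ^ n) (fun n => by fun_prop) ?_ ?_ (by simp) ?_
      · refine fun n => Eventually.of_forall fun t ht => ?_
        rw [norm_mul, norm_pow, Real.norm_eq_abs, Real.norm_eq_abs]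
        refine mul_le_mul_of_nonneg_left (pow_le_pow_left₀ (abs_nonneg _) ?_ n) (abs_nonneg _)
        have := Set.abs_sub_left_of_mem_uIcc (Set.uIoc_subset_uIcc ht)
        simpa using this
      · refine Eventually.of_forall fun t _ => ?_
        have := (hs x hx).summable.abs
        simpa [abs_mul] using this
      · refine Eventually.of_forall fun t ht => hs t ?_
        have := Set.abs_sub_left_of_mem_uIcc (Set.uIoc_subset_uIcc ht)
        exact lt_of_le_of_lt (by simpa using this) hx
    -- The constant term of g vanishes, so the series of G starts at x² and that factor can be taken
    -- out.
    rw [← hasSum_nat_add_iff' 1] at hint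
    have h2 := (hhs x hx).mul_left (x ^ 2)
    have h3 : ∀ n : ℕ, ∫ ξ in (0 : ℝ)..x, c (n + 1) * ξ ^ (n + 1) =
        x ^ 2 * (c (n + 1) / (n + 2) * x ^ n) := fun n => by
      rw [intervalIntegral.integral_const_mul, integral_pow]
      push_cast
      have : (n : ℝ) + 2 ≠ 0 := by positivity
      have : (n : ℝ) + 1 + 1 ≠ 0 := by positivity
      field_simp
      ring
    simp only [h3] at hint
    simpa [hc0, hg0] using hint.unique h2

/-- Averaging the series at u and -u kills the odd coefficients; the factor 2 ^ n in the remaining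
ones compensates for the variable u²/2. -/
theorem AnalyticAt.exists_eq_comp_sq_of_even {p : ℝ → ℝ} (hp : AnalyticAt ℝ p 0)
    (heven : ∀ᶠ u in 𝓝 (0 : ℝ), p (-u) = p u) :
    ∃ F : ℝ → ℝ, AnalyticAt ℝ F 0 ∧ ∀ᶠ u in 𝓝 (0 : ℝ), F (u ^ 2 / 2) = p u := by
  obtain ⟨c, ρ, C, hρ, hC, hs, -, -⟩ := hp.exists_real_coeff
  have hd : ∀ n, |c (2 * n) * 2 ^ n| * (ρ ^ 2 / 2) ^ n ≤ C := fun n => by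
    refine le_of_eq_of_le ?_ (hC (2 * n))
    rw [abs_mul, abs_of_pos (by positivity : (0 : ℝ) < 2 ^ n), mul_assoc, ← mul_pow, pow_mul]
    congr 2
    ring
  obtain ⟨F, hF, hFs⟩ := exists_analyticAt_hasSum (by positivity) hd
  refine ⟨F, hF, ?_⟩
  have hball := eventually_abs_lt_of_pos hρ
  filter_upwards [hball, heven] with u hu hev
  have h1 : HasSum (fun n => c (2 * n) * 2 ^ n * (u ^ 2 / 2) ^ n) (F (u ^ 2 / 2)) := by
    refine hFs _ ?_
    rw [abs_of_nonneg (by positivity), ← sq_abs]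
    gcongr
  have h2 := ((hs u hu).add (hs (-u) (by simpa using hu))).div_const 2
  rw [hev, add_self_div_two] at h2
  have hinj : Function.Injective (fun n : ℕ => 2 * n) := fun m n h => by simpa using h
  rw [← hinj.hasSum_iff] at h2
  · refine h1.unique ?_
    refine (congrArg (fun f => HasSum f (p u)) (funext fun n => ?_)).mp h2
    simp only [Function.comp, (even_two_mul n).neg_pow, add_self_div_two]
    rw [mul_assoc, ← mul_pow, pow_mul, mul_div_cancel₀ _ two_ne_zero]
  · intro n hn
    have : Odd n := by
      rw [← Nat.not_even_iff_odd]
      rintro ⟨k, hk⟩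
      exact hn ⟨k, by simp only; omega⟩
    rw [this.neg_pow]
    ring

/-! ### The chart normalising the potential -/

/-- Near a nondegenerate centre, an analytic change of variable `x = X u` normalises the potential
to `u² / 2`. -/
theorem exists_potential_chart {g : ℝ → ℝ} (hg : AnalyticAt ℝ g 0) (hg0 : g 0 = 0)
    (hg1 : deriv g 0 = 1) :
    ∃ X U : ℝ → ℝ, AnalyticAt ℝ X 0 ∧ AnalyticAt ℝ U 0 ∧ X 0 = 0 ∧ U 0 = 0 ∧ deriv X 0 = 1 ∧
      (∀ᶠ u in 𝓝 (0 : ℝ), U (X u) = u) ∧ (∀ᶠ x in 𝓝 (0 : ℝ), X (U x) = x) ∧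
      (∀ᶠ u in 𝓝 (0 : ℝ), potential g (X u) = u ^ 2 / 2) := by
  obtain ⟨h, hh, hh0, hGh⟩ := exists_potential_eq_sq_mul hg hg0
  rw [hg1] at hh0
  -- The signed square root of 2G; it is analytic because 2h(0) = 1 > 0, and X is its local inverse.
  set U : ℝ → ℝ := fun x => x * √(2 * h x) with hU
  have hsa : AnalyticAt ℝ (fun x => √(2 * h x)) 0 :=
    ContDiffAt.analyticAt ((analyticAt_const.mul hh).contDiffAt.sqrt (by norm_num [hh0]))
  have hUa : AnalyticAt ℝ U 0 := analyticAt_id.mul hsa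
  have hU0 : U 0 = 0 := by simp [hU]
  have hU1 : deriv U 0 = 1 := by
    have := (hasDerivAt_id (0 : ℝ)).mul hsa.differentiableAt.hasDerivAt
    refine this.deriv.trans ?_
    simp [hh0]
  have hU1' : deriv U 0 ≠ 0 := by simp [hU1]
  set X := hUa.hasStrictDerivAt.localInverse _ _ _ hU1' with hX
  have hXa : AnalyticAt ℝ X (U 0) := hUa.analyticAt_localInverse hU1'
  have hXU : ∀ᶠ x in 𝓝 (0 : ℝ), X (U x) = x :=
    hUa.hasStrictDerivAt.eventually_left_inverse hU1'
  have hUX : ∀ᶠ u in 𝓝 (U 0), U (X u) = u :=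
    hUa.hasStrictDerivAt.eventually_right_inverse hU1'
  have hX1 : HasStrictDerivAt X (deriv U 0)⁻¹ (U 0) := hUa.hasStrictDerivAt.to_localInverse hU1'
  rw [hU0] at hXa hUX hX1
  have hX0 : X 0 = 0 := by simpa [hU0] using hXU.self_of_nhds
  refine ⟨X, U, hXa, hUa, hX0, hU0, ?_, hUX, hXU, ?_⟩
  · simpa [hU1] using hX1.hasDerivAt.deriv
  · have hXt : Tendsto X (𝓝 0) (𝓝 0) := by simpa [hX0] using hXa.continuousAt.tendsto
    have hpos : ∀ᶠ x in 𝓝 (0 : ℝ), 0 < h x :=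
      hh.continuousAt.eventually_const_lt (by norm_num [hh0])
    filter_upwards [hUX, hXt.eventually hGh, hXt.eventually hpos] with u h1 h2 h3
    have h4 : (X u * √(2 * h (X u))) ^ 2 = u ^ 2 := congrArg (· ^ 2) h1
    rw [mul_pow, Real.sq_sqrt (by positivity)] at h4
    rw [h2, ← h4]
    ring

theorem hasDerivAt_potential {g : ℝ → ℝ} (hg : AnalyticAt ℝ g 0) :
    ∀ᶠ x in 𝓝 (0 : ℝ), HasDerivAt (potential g) (g x) x := by
  obtain ⟨ε, hε, h⟩ := Metric.eventually_nhds_iff_ball.1 hg.eventually_analyticAt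
  filter_upwards [Metric.ball_mem_nhds (0 : ℝ) hε] with x hx
  have hc : ContinuousOn g (Metric.ball 0 ε) := fun y hy => (h y hy).continuousAt.continuousWithinAt
  have hseg : Set.uIcc 0 x ⊆ Metric.ball 0 ε :=
    (convex_ball (0 : ℝ) ε).ordConnected.uIcc_subset (Metric.mem_ball_self hε) hx
  exact intervalIntegral.integral_hasDerivAt_right ((hc.mono hseg).intervalIntegrable)
    (hc.stronglyMeasurableAtFilter Metric.isOpen_ball x hx) (h x hx).continuousAt

/-- The conjugacy relation `g (X u) X'(u) = u`, obtained by differentiating `G (X u) = u² / 2`. -/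
theorem eventually_mul_deriv_eq_of_potential_comp {g X : ℝ → ℝ} (hg : AnalyticAt ℝ g 0)
    (hX : AnalyticAt ℝ X 0) (hX0 : X 0 = 0)
    (hGX : ∀ᶠ u in 𝓝 (0 : ℝ), potential g (X u) = u ^ 2 / 2) :
    ∀ᶠ u in 𝓝 (0 : ℝ), g (X u) * deriv X u = u := by
  have hXt : Tendsto X (𝓝 0) (𝓝 0) := by simpa [hX0] using hX.continuousAt.tendsto
  filter_upwards [hGX.eventually_nhds, hXt.eventually (hasDerivAt_potential hg),
    hX.eventually_analyticAt] with u h1 h2 h3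
  have h4 := h2.comp u h3.differentiableAt.hasDerivAt
  have h5 : HasDerivAt (fun u : ℝ => u ^ 2 / 2) u u := by
    simpa using ((hasDerivAt_id u).pow 2).div_const 2
  exact h4.unique (h5.congr_of_eventuallyEq h1)

/-! ### Closed orbits and their periods -/

/-- A positive continuous periodic density is the inverse speed of a global phase. -/
theorem exists_phase_of_periodic {w : ℝ → ℝ} {P : ℝ} (hP : 0 < P) (hw : Continuous w)
    (hpos : ∀ s, 0 < w s) (hper : Function.Periodic w P) (θ₀ : ℝ) :
    ∃ θ : ℝ → ℝ, StrictMono θ ∧ θ 0 = θ₀ ∧ (∀ t, HasDerivAt θ (w (θ t))⁻¹ t) ∧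
      ∀ t, θ (t + ∫ s in (0 : ℝ)..P, w s) = θ t + P := by
  have hint : ∀ x y, IntervalIntegrable w MeasureTheory.volume x y :=
    fun x y => hw.intervalIntegrable x y
  -- S is the time needed to reach phase x. It is a bijection of the line, since a positive periodic
  -- density has divergent integrals, and θ is its inverse.
  set S : ℝ → ℝ := fun x => ∫ s in θ₀..x, w s with hS
  have hSd : ∀ x, HasDerivAt S (w x) x := fun x => hw.integral_hasStrictDerivAt θ₀ x |>.hasDerivAt
  have hSm : StrictMono S := strictMono_of_hasDerivAt_pos hSd hpos
  have hSadd : S = fun x => (∫ s in (0 : ℝ)..x, w s) + -∫ s in (0 : ℝ)..θ₀, w s :=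
    funext fun x => by
      rw [← sub_eq_add_neg, intervalIntegral.integral_interval_sub_left (hint _ _) (hint _ _)]
  have hSs : Function.Surjective S := by
    refine (continuous_iff_continuousAt.2 fun x => (hSd x).continuousAt).surjective ?_ ?_
    · rw [hSadd]
      exact tendsto_atTop_add_const_right _ _
        (hper.tendsto_atTop_intervalIntegral_of_pos' (hint _ _) hpos hP)
    · rw [hSadd]
      exact tendsto_atBot_add_const_right _ _
        (hper.tendsto_atBot_intervalIntegral_of_pos' (hint _ _) hpos hP)
  set e := hSm.orderIsoOfSurjective S hSs with he
  have heS : ∀ x, e x = S x := fun x => rfl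
  have hSe : ∀ t, S (e.symm t) = t := fun t => e.apply_symm_apply t
  refine ⟨e.symm, e.symm.strictMono, ?_, fun t => ?_, fun t => ?_⟩
  · rw [OrderIso.symm_apply_eq, heS]
    simp [hS]
  · exact (hSd _).of_local_left_inverse e.symm.continuous.continuousAt (hpos _).ne'
      (Eventually.of_forall hSe)
  · rw [OrderIso.symm_apply_eq, heS]
    have h1 : S (e.symm t + P) = S (e.symm t) + ∫ s in e.symm t..e.symm t + P, w s :=
      (intervalIntegral.integral_add_adjacent_intervals (hint _ _) (hint _ _)).symm
    rw [h1, hSe, hper.intervalIntegral_add_eq (e.symm t) 0, zero_add]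

/-- `X` is a chart on `(-ρ, ρ)` conjugating `x'' + g x = 0` to a rotation with variable speed. -/
structure IsPotentialChart (g X : ℝ → ℝ) (ρ : ℝ) : Prop where
  analyticAt : ∀ u, |u| < ρ → AnalyticAt ℝ X u
  deriv_pos : ∀ u, |u| < ρ → 0 < deriv X u
  mul_deriv : ∀ u, |u| < ρ → g (X u) * deriv X u = u
  injOn : ∀ u v, |u| < ρ → |v| < ρ → X u = X v → u = v
  analyticAt_field : ∀ u, |u| < ρ → AnalyticAt ℝ g (X u)

/-- The period of the orbit of energy `r² / 2` in terms of the chart `X`. -/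
noncomputable def orbitPeriod (X : ℝ → ℝ) (r : ℝ) : ℝ :=
  ∫ s in (0 : ℝ)..2 * Real.pi, deriv X (r * Real.sin s)

theorem abs_mul_sin_lt {r ρ : ℝ} (hr : 0 ≤ r) (hrρ : r < ρ) (s : ℝ) : |r * Real.sin s| < ρ := by
  rw [abs_mul, abs_of_nonneg hr]
  exact (mul_le_of_le_one_right hr (Real.abs_sin_le_one s)).trans_lt hrρ

theorem IsPotentialChart.continuous_deriv_mul_sin {g X : ℝ → ℝ} {ρ r : ℝ}
    (h : IsPotentialChart g X ρ) (hr : 0 ≤ r) (hrρ : r < ρ) :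
    Continuous fun s => deriv X (r * Real.sin s) :=
  continuous_iff_continuousAt.2 fun s =>
    ContinuousAt.comp (f := fun s => r * Real.sin s)
      (h.analyticAt _ (abs_mul_sin_lt hr hrρ s)).deriv.continuousAt
      (by fun_prop)

theorem IsPotentialChart.exists_periodic_integralCurve {g X : ℝ → ℝ} {ρ r : ℝ}
    (h : IsPotentialChart g X ρ) (hr : 0 < r) (hrρ : r < ρ) (θ₀ : ℝ) :
    ∃ γ : ℝ → ℝ × ℝ, IsIntegralCurve γ (fun _ => planarField g) ∧
      γ 0 = (X (r * Real.sin θ₀), r * Real.cos θ₀) ∧ IsMinimalPeriod γ (orbitPeriod X r) ∧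
      ∀ t, AnalyticAt ℝ g (γ t).1 := by
  have hb := abs_mul_sin_lt hr.le hrρ
  obtain ⟨θ, hmono, hθ0, hθd, hθp⟩ := exists_phase_of_periodic Real.two_pi_pos
    (h.continuous_deriv_mul_sin hr.le hrρ) (fun s => h.deriv_pos _ (hb s))
    (fun s => by simp only [Real.sin_add_two_pi]) θ₀
  have hpos : 0 < orbitPeriod X r := by
    have h1 := hθp 0
    have h2 : θ 0 < θ (0 + orbitPeriod X r) := by
      rw [orbitPeriod, h1]
      linarith [Real.two_pi_pos]
    simpa using hmono.lt_iff_lt.1 h2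
  refine ⟨fun t => (X (r * Real.sin (θ t)), r * Real.cos (θ t)), fun t => ?_, by simp only [hθ0],
    ⟨⟨hpos, fun t => ?_⟩, ?_⟩, fun t => h.analyticAt_field _ (hb _)⟩
  · have hne := (h.deriv_pos _ (hb (θ t))).ne'
    have h1 : HasDerivAt (fun t => X (r * Real.sin (θ t))) (r * Real.cos (θ t)) t := by
      have := (h.analyticAt _ (hb (θ t))).differentiableAt.hasDerivAt.comp t
        ((hθd t).sin.const_mul r)
      refine this.congr_deriv ?_
      rw [mul_comm, mul_assoc r, mul_assoc (Real.cos _), inv_mul_cancel₀ hne, mul_one]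
    have h2 : HasDerivAt (fun t => r * Real.cos (θ t)) (-g (X (r * Real.sin (θ t)))) t := by
      refine ((hθd t).cos.const_mul r).congr_deriv ?_
      have := h.mul_deriv _ (hb (θ t))
      rw [← div_eq_mul_inv, ← mul_div_assoc, div_eq_iff hne]
      linarith
    exact h1.prodMk h2
  · have := hθp t
    simp only [orbitPeriod, this, Real.sin_add_two_pi, Real.cos_add_two_pi]
  · rintro τ ⟨hτ, hτp⟩
    have h0 := hτp 0
    simp only [zero_add, Prod.mk.injEq, hθ0] at h0
    have hsin : Real.sin (θ τ) = Real.sin θ₀ :=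
      mul_left_cancel₀ hr.ne' (h.injOn _ _ (hb _) (hb _) h0.1)
    have hcos : Real.cos (θ τ) = Real.cos θ₀ := mul_left_cancel₀ hr.ne' h0.2
    -- A return to the starting point advances the increasing phase by a positive multiple of 2π,
    -- hence by at least one full turn.
    have hang : (θ τ : Real.Angle) = θ₀ := Real.Angle.cos_sin_inj hcos hsin
    obtain ⟨k, hk⟩ := Real.Angle.angle_eq_iff_two_pi_dvd_sub.1 hang
    have hlt : θ₀ < θ τ := hθ0 ▸ hmono hτ
    have hk1 : (1 : ℝ) ≤ k := by
      have : (0 : ℝ) < k := by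
        by_contra! hle
        nlinarith [Real.two_pi_pos]
      exact_mod_cast this
    have hle : θ (0 + orbitPeriod X r) ≤ θ τ := by
      rw [orbitPeriod, hθp 0, hθ0]
      nlinarith [Real.two_pi_pos]
    simpa using hmono.le_iff_le.1 hle

theorem planarField_contDiffAt {g : ℝ → ℝ} {p : ℝ × ℝ} (hg : AnalyticAt ℝ g p.1) :
    ContDiffAt ℝ 1 (planarField g) p := by
  have h1 : ContDiffAt ℝ 1 (fun q : ℝ × ℝ => g q.1) p := hg.contDiffAt.comp p contDiffAt_fst
  exact contDiffAt_snd.prodMk h1.neg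

/-- Global uniqueness of integral curves along which the vector field is `C¹`. -/
theorem IsIntegralCurve.eq_of_contDiffAt {E : Type*} [NormedAddCommGroup E] [NormedSpace ℝ E]
    {v : E → E} {γ₁ γ₂ : ℝ → E} (h₁ : IsIntegralCurve γ₁ fun _ => v)
    (h₂ : IsIntegralCurve γ₂ fun _ => v) (hv : ∀ t, ContDiffAt ℝ 1 v (γ₁ t))
    (h0 : γ₁ 0 = γ₂ 0) : γ₁ = γ₂ := by
  -- Closed by continuity; open by local Lipschitz uniqueness at a common point, so regularity along
  -- γ₁ alone suffices.
  have hclopen : IsClopen {t | γ₁ t = γ₂ t} := by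
    refine ⟨isClosed_eq h₁.continuous h₂.continuous, isOpen_iff_mem_nhds.2 fun t ht => ?_⟩
    obtain ⟨K, s, hs, hK⟩ := (hv t).exists_lipschitzOnWith
    refine ODE_solution_unique_of_eventually (v := fun _ => v) (s := fun _ => s) (K := K)
      (Eventually.of_forall fun _ => hK) ?_ ?_ ht
    · filter_upwards [h₁.continuous.continuousAt hs] with x hx using ⟨h₁ x, hx⟩
    · have hs' : s ∈ 𝓝 (γ₂ t) := by rwa [← show γ₁ t = γ₂ t from ht]
      filter_upwards [h₂.continuous.continuousAt hs'] with x hx using ⟨h₂ x, hx⟩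
  have huniv := hclopen.eq_univ ⟨0, h0⟩
  exact funext fun t => (huniv.symm.le (Set.mem_univ t) :)

theorem IsMinimalPeriod.unique {γ : ℝ → ℝ × ℝ} {S T : ℝ} (hS : IsMinimalPeriod γ S)
    (hT : IsMinimalPeriod γ T) : S = T :=
  IsLeast.unique hS hT

/-! ### Constant period and the even part of the derivative of the chart -/

theorem continuous_comp_neg_mul_sin {f : ℝ → ℝ} {r : ℝ}
    (hf : Continuous fun s => f (r * Real.sin s)) :
    Continuous fun s => f (-(r * Real.sin s)) := by
  have := hf.comp (continuous_add_const Real.pi)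
  simpa [Function.comp_def, Real.sin_add_pi] using this

/-- The shift s ↦ s + π changes the sign of the sine and folds the second half turn onto the first.
-/
theorem orbitPeriod_eq_integral_zero_pi {X : ℝ → ℝ} {r : ℝ}
    (hc : Continuous fun s => deriv X (r * Real.sin s)) :
    orbitPeriod X r =
      ∫ s in (0 : ℝ)..Real.pi, (deriv X (r * Real.sin s) + deriv X (-(r * Real.sin s))) := by
  have hc' := continuous_comp_neg_mul_sin hc
  rw [intervalIntegral.integral_add (hc.intervalIntegrable _ _) (hc'.intervalIntegrable _ _)]
  have hshift : ∫ s in (0 : ℝ)..Real.pi, deriv X (-(r * Real.sin s)) =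
      ∫ s in Real.pi..2 * Real.pi, deriv X (r * Real.sin s) := by
    have := intervalIntegral.integral_comp_add_right (a := 0) (b := Real.pi)
      (fun s => deriv X (r * Real.sin s)) Real.pi
    simpa [Real.sin_add_pi, two_mul] using this
  rw [hshift, intervalIntegral.integral_add_adjacent_intervals (hc.intervalIntegrable _ _)
    (hc.intervalIntegrable _ _), orbitPeriod]

/-- If the period does not depend on the orbit, then `X'` has constant even part. -/
theorem IsPotentialChart.eventually_deriv_add_deriv_neg {g X : ℝ → ℝ} {ρ T : ℝ}
    (h : IsPotentialChart g X ρ) (hρ : 0 < ρ) (hX1 : deriv X 0 = 1)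
    (hT : ∀ᶠ r in 𝓝[>] (0 : ℝ), orbitPeriod X r = T) :
    ∀ᶠ u in 𝓝 (0 : ℝ), deriv X u + deriv X (-u) = 2 := by
  have hXa : AnalyticAt ℝ (deriv X) 0 := (h.analyticAt 0 (by simpa using hρ)).deriv
  have hea : AnalyticAt ℝ (fun u => deriv X u + deriv X (-u) - T / Real.pi) 0 :=
    (hXa.add (hXa.comp_of_eq analyticAt_id.neg (by simp))).sub analyticAt_const
  -- In the first case, evaluation at 0 gives T/π = 2. In the second, a single small r yields a
  -- contradiction.
  rcases hea.eventually_eq_zero_or_eventually_ne_zero with h0 | hne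
  · have h1 := h0.self_of_nhds
    simp only [neg_zero, hX1] at h1
    filter_upwards [h0] with u hu
    linarith
  · exfalso
    obtain ⟨δ, hδ, hne⟩ := Metric.eventually_nhds_iff_ball.1 (eventually_nhdsWithin_iff.1 hne)
    obtain ⟨r, hrT, hr0, hrm⟩ := (hT.and (Ioo_mem_nhdsGT (lt_min hρ hδ))).exists
    have hrρ := hrm.trans_le (min_le_left _ _)
    have hrδ := hrm.trans_le (min_le_right _ _)
    have hc := h.continuous_deriv_mul_sin hr0.le hrρ
    have hc' := continuous_comp_neg_mul_sin hc
    have hsum : Continuous fun s => deriv X (r * Real.sin s) + deriv X (-(r * Real.sin s)) :=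
      hc.add hc'
    have hcont : Continuous fun s =>
        deriv X (r * Real.sin s) + deriv X (-(r * Real.sin s)) - T / Real.pi :=
      hsum.sub continuous_const
    have hint : ∫ s in (0 : ℝ)..Real.pi,
        (deriv X (r * Real.sin s) + deriv X (-(r * Real.sin s)) - T / Real.pi) = 0 := by
      rw [intervalIntegral.integral_sub (hsum.intervalIntegrable _ _)
        (continuous_const.intervalIntegrable _ _), ← orbitPeriod_eq_integral_zero_pi hc, hrT]
      simp
    have hderiv := fun t => (hcont.integral_hasStrictDerivAt 0 t).hasDerivAt
    -- Rolle for the primitive: the integrand vanishes at some s in (0, π), where r sin s is small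
    -- and nonzero.
    obtain ⟨s, hs, hs0⟩ := exists_hasDerivAt_eq_zero Real.pi_pos
      (fun t _ => (hderiv t).continuousAt.continuousWithinAt)
      (by rw [hint, intervalIntegral.integral_same]) (fun t _ => hderiv t)
    refine hne (r * Real.sin s) ?_ (mul_pos hr0 (Real.sin_pos_of_mem_Ioo hs)).ne' hs0
    simpa [abs_mul] using abs_mul_sin_lt hr0.le hrδ s

theorem IsPotentialChart.eventually_orbitPeriod_eq {g X : ℝ → ℝ} {ρ : ℝ}
    (h : IsPotentialChart g X ρ) (hρ : 0 < ρ)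
    (hX : ∀ᶠ u in 𝓝 (0 : ℝ), deriv X u + deriv X (-u) = 2) :
    ∀ᶠ r in 𝓝[>] (0 : ℝ), orbitPeriod X r = 2 * Real.pi := by
  obtain ⟨δ, hδ, hX⟩ := Metric.eventually_nhds_iff_ball.1 hX
  filter_upwards [Ioo_mem_nhdsGT (lt_min hρ hδ)] with r ⟨hr0, hrm⟩
  have hrρ := hrm.trans_le (min_le_left _ _)
  have hrδ := hrm.trans_le (min_le_right _ _)
  rw [orbitPeriod_eq_integral_zero_pi (h.continuous_deriv_mul_sin hr0.le hrρ)]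
  have : ∀ s, deriv X (r * Real.sin s) + deriv X (-(r * Real.sin s)) = 2 := fun s =>
    hX _ (by simpa using abs_mul_sin_lt hr0.le hrδ s)
  simp [this, mul_comm]

theorem eventually_eq_of_eventually_deriv_eq_zero {f : ℝ → ℝ} (hf : AnalyticAt ℝ f 0)
    (h : ∀ᶠ u in 𝓝 (0 : ℝ), deriv f u = 0) : ∀ᶠ u in 𝓝 (0 : ℝ), f u = f 0 := by
  obtain ⟨ε, hε, h⟩ := Metric.eventually_nhds_iff_ball.1 (h.and hf.eventually_analyticAt)
  filter_upwards [Metric.ball_mem_nhds (0 : ℝ) hε] with u hu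
  exact Metric.isOpen_ball.is_const_of_deriv_eq_zero (convex_ball (0 : ℝ) ε).isPreconnected
    (fun v hv => (h v hv).2.differentiableAt.differentiableWithinAt) (fun v hv => (h v hv).1)
    hu (Metric.mem_ball_self hε)

theorem hasDerivAt_sub_comp_neg {X : ℝ → ℝ} {u : ℝ} (h : DifferentiableAt ℝ X u)
    (h' : DifferentiableAt ℝ X (-u)) :
    HasDerivAt (fun u => X u - X (-u)) (deriv X u + deriv X (-u)) u := by
  have h2 := h'.hasDerivAt.comp u (hasDerivAt_neg u)
  exact (h.hasDerivAt.sub h2).congr_deriv (by ring)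

theorem eventually_comp_neg {p : ℝ → Prop} (h : ∀ᶠ u in 𝓝 (0 : ℝ), p u) :
    ∀ᶠ u in 𝓝 (0 : ℝ), p (-u) := by
  have : Tendsto (fun u : ℝ => -u) (𝓝 0) (𝓝 0) := by
    simpa using (continuous_neg (G := ℝ)).tendsto 0
  exact this.eventually h

/-- `X'` has constant even part iff `u X'(u) - X(u)` is even. -/
theorem eventually_deriv_add_deriv_neg_iff {X : ℝ → ℝ} (hX : AnalyticAt ℝ X 0)
    (hX1 : deriv X 0 = 1) :
    (∀ᶠ u in 𝓝 (0 : ℝ), deriv X u + deriv X (-u) = 2) ↔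
      ∀ᶠ u in 𝓝 (0 : ℝ), -u * deriv X (-u) - X (-u) = u * deriv X u - X u := by
  have han := hX.eventually_analyticAt
  have hD : ∀ᶠ u in 𝓝 (0 : ℝ),
      HasDerivAt (fun u => X u - X (-u)) (deriv X u + deriv X (-u)) u := by
    filter_upwards [han, eventually_comp_neg han] with u h1 h2
    exact hasDerivAt_sub_comp_neg h1.differentiableAt h2.differentiableAt
  have hDa : AnalyticAt ℝ (fun u => X u - X (-u)) 0 :=
    hX.sub (hX.comp_of_eq analyticAt_id.neg (by simp))
  have hWa : AnalyticAt ℝ (fun u => deriv X u + deriv X (-u)) 0 :=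
    hX.deriv.add (hX.deriv.comp_of_eq analyticAt_id.neg (by simp))
  constructor
  · intro h
    have h0 : ∀ᶠ u in 𝓝 (0 : ℝ), deriv (fun u => X u - X (-u) - 2 * u) u = 0 := by
      filter_upwards [h, hD] with u h1 h2
      have h3 := h2.sub ((hasDerivAt_id u).const_mul 2)
      rw [h1] at h3
      exact h3.deriv.trans (by ring)
    have := eventually_eq_of_eventually_deriv_eq_zero
      (hDa.sub (analyticAt_const.mul analyticAt_id)) h0
    filter_upwards [this, h] with u h1 h2
    have h3 : X u - X (-u) - 2 * u = X 0 - X (-0) - 2 * 0 := h1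
    rw [neg_zero] at h3
    linear_combination -u * h2 + h3
  · intro h
    have hEq : ∀ᶠ u in 𝓝 (0 : ℝ), u * (deriv X u + deriv X (-u)) = X u - X (-u) := by
      filter_upwards [h] with u hu
      linear_combination -hu
    -- Put W = D'. Differentiating u W = D gives u W' = 0; analyticity then extends W' = 0 to u = 0.
    have h0 : ∀ᶠ u in 𝓝[≠] (0 : ℝ), deriv (fun u => deriv X u + deriv X (-u)) u = 0 := by
      rw [eventually_nhdsWithin_iff]
      filter_upwards [hEq.eventually_nhds, hD, hWa.eventually_analyticAt] with u h1 h2 h3 hu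
      have h4 := (hasDerivAt_id u).mul h3.differentiableAt.hasDerivAt
      have h5 := h4.unique (h2.congr_of_eventuallyEq h1)
      have h6 : u * deriv (fun u => deriv X u + deriv X (-u)) u = 0 := by
        simp only [id] at h5
        linear_combination h5
      exact (mul_eq_zero.1 h6).resolve_left hu
    have h1 := hWa.deriv.frequently_zero_iff_eventually_zero.1 h0.frequently
    filter_upwards [eventually_eq_of_eventually_deriv_eq_zero hWa h1] with u hu
    rw [hu, neg_zero, hX1]
    norm_num

/-! ### Translating both sides of the equivalence into the chart -/

theorem exists_isPotentialChart {g X U : ℝ → ℝ} (hg : AnalyticAt ℝ g 0) (hX : AnalyticAt ℝ X 0)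
    (hX0 : X 0 = 0) (hX1 : deriv X 0 = 1) (hUX : ∀ᶠ u in 𝓝 (0 : ℝ), U (X u) = u)
    (hconj : ∀ᶠ u in 𝓝 (0 : ℝ), g (X u) * deriv X u = u) :
    ∃ ρ > 0, IsPotentialChart g X ρ := by
  have hXt : Tendsto X (𝓝 0) (𝓝 0) := by simpa [hX0] using hX.continuousAt.tendsto
  have hpos : ∀ᶠ u in 𝓝 (0 : ℝ), 0 < deriv X u :=
    hX.deriv.continuousAt.eventually_const_lt (by norm_num [hX1])
  obtain ⟨ρ, hρ, h⟩ := Metric.eventually_nhds_iff_ball.1 (hX.eventually_analyticAt.and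
    (hpos.and (hconj.and (hUX.and (hXt.eventually hg.eventually_analyticAt)))))
  have hb : ∀ u, |u| < ρ → u ∈ Metric.ball (0 : ℝ) ρ := fun u hu => by simpa using hu
  refine ⟨ρ, hρ, fun u hu => (h u (hb u hu)).1, fun u hu => (h u (hb u hu)).2.1,
    fun u hu => (h u (hb u hu)).2.2.1, fun u v hu hv huv => ?_,
    fun u hu => (h u (hb u hu)).2.2.2.2⟩
  rw [← (h u (hb u hu)).2.2.2.1, ← (h v (hb v hv)).2.2.2.1, huv]

theorem exists_polar_coord {u y : ℝ} (h : u ≠ 0 ∨ y ≠ 0) :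
    0 < √(u ^ 2 + y ^ 2) ∧ ∃ θ : ℝ, √(u ^ 2 + y ^ 2) * Real.sin θ = u ∧
      √(u ^ 2 + y ^ 2) * Real.cos θ = y := by
  -- The complex number is y + iu, because u carries the sine and y the cosine.
  have hnorm : ‖(⟨y, u⟩ : ℂ)‖ = √(u ^ 2 + y ^ 2) := by
    rw [Complex.norm_def, Complex.normSq_mk]
    congr 1
    ring
  refine ⟨Real.sqrt_pos.2 ?_, Complex.arg ⟨y, u⟩, ?_, ?_⟩
  · rcases h with h | h <;> positivity
  · rw [← hnorm, Complex.norm_mul_sin_arg]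
  · rw [← hnorm, Complex.norm_mul_cos_arg]

/-- The centre is isochronous iff the orbit period is locally constant. -/
theorem isIsochronousCenter_iff_orbitPeriod {g X U : ℝ → ℝ} {ρ : ℝ} (hg0 : g 0 = 0)
    (hρ : 0 < ρ) (h : IsPotentialChart g X ρ) (hX0 : X 0 = 0) (hU : ContinuousAt U 0)
    (hU0 : U 0 = 0) (hXU : ∀ᶠ x in 𝓝 (0 : ℝ), X (U x) = x) :
    IsIsochronousCenter (planarField g) (0, 0) ↔
      ∃ T, ∀ᶠ r in 𝓝[>] (0 : ℝ), orbitPeriod X r = T := by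
  constructor
  · rintro ⟨-, T, hT⟩
    refine ⟨T, ?_⟩
    have ht : Tendsto (fun r : ℝ => ((0 : ℝ), r)) (𝓝[>] 0) (𝓝[≠] (0, 0)) := by
      refine tendsto_nhdsWithin_iff.2 ⟨?_, ?_⟩
      · exact (Continuous.tendsto' (by fun_prop) _ _ rfl).mono_left nhdsWithin_le_nhds
      · filter_upwards [self_mem_nhdsWithin] with r hr
        simpa using (ne_of_gt hr : r ≠ 0)
    filter_upwards [ht.eventually hT, Ioo_mem_nhdsGT hρ] with r ⟨γ, hγ, hγ0, hγT⟩ ⟨hr0, hrρ⟩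
    -- Phase 0 is the point (0, r); uniqueness identifies the given orbit with the explicit one.
    obtain ⟨γ', hγ', hγ'0, hγ'T, hγ'a⟩ := h.exists_periodic_integralCurve hr0 hrρ 0
    have : γ' = γ := hγ'.eq_of_contDiffAt hγ (fun t => planarField_contDiffAt (hγ'a t))
      (by rw [hγ0, hγ'0]; simp [hX0])
    exact hγ'T.unique (this ▸ hγT)
  · rintro ⟨T, hT⟩
    refine ⟨by simp [planarField, hg0], T, ?_⟩
    have hR : Tendsto (fun q : ℝ × ℝ => √(U q.1 ^ 2 + q.2 ^ 2)) (𝓝 (0, 0)) (𝓝 0) := by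
      have hUq : ContinuousAt (fun q : ℝ × ℝ => U q.1) (0, 0) :=
        ContinuousAt.comp (f := Prod.fst) (x := ((0 : ℝ), (0 : ℝ))) hU continuousAt_fst
      have : ContinuousAt (fun q : ℝ × ℝ => √(U q.1 ^ 2 + q.2 ^ 2)) (0, 0) :=
        ((hUq.pow 2).add (continuousAt_snd.pow 2)).sqrt
      simpa [ContinuousAt, hU0] using this
    have hT' := eventually_nhdsWithin_iff.1 hT
    have hfst : Tendsto (Prod.fst : ℝ × ℝ → ℝ) (𝓝 (0, 0)) (𝓝 0) := continuousAt_fst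
    rw [eventually_nhdsWithin_iff]
    filter_upwards [hR.eventually hT', hR.eventually (gt_mem_nhds hρ), hfst.eventually hXU]
      with q h1 h2 h3 hq
    have hne : U q.1 ≠ 0 ∨ q.2 ≠ 0 := by
      by_contra! hcon
      rw [hcon.1, hX0] at h3
      exact hq (Prod.ext h3.symm hcon.2)
    obtain ⟨hr0, θ₀, hsin, hcos⟩ := exists_polar_coord hne
    obtain ⟨γ, hγ, hγ0, hγT, -⟩ := h.exists_periodic_integralCurve hr0 h2 θ₀
    refine ⟨γ, hγ, ?_, h1 hr0 ▸ hγT⟩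
    rw [hγ0, hsin, hcos, h3]

/-- In the chart, the functional equation for `F` says that `u X'(u) - X(u)` is even. -/
theorem exists_analyticAt_potential_iff {g X U : ℝ → ℝ} (hX : AnalyticAt ℝ X 0)
    (hX0 : X 0 = 0) (hU : ContinuousAt U 0) (hU0 : U 0 = 0)
    (hXU : ∀ᶠ x in 𝓝 (0 : ℝ), X (U x) = x)
    (hGX : ∀ᶠ u in 𝓝 (0 : ℝ), potential g (X u) = u ^ 2 / 2)
    (hconj : ∀ᶠ u in 𝓝 (0 : ℝ), g (X u) * deriv X u = u) :
    (∃ F : ℝ → ℝ, AnalyticAt ℝ F 0 ∧ ∀ᶠ x in 𝓝 (0 : ℝ),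
        2 * potential g x - x * g x = g x * F (potential g x)) ↔
      ∀ᶠ u in 𝓝 (0 : ℝ), -u * deriv X (-u) - X (-u) = u * deriv X u - X u := by
  constructor
  · rintro ⟨F, -, hF⟩
    have hXt : Tendsto X (𝓝 0) (𝓝 0) := by simpa [hX0] using hX.continuousAt.tendsto
    -- At u = 0 the equation is void since g vanishes there, but evenness at 0 is trivial.
    have key : ∀ᶠ u in 𝓝 (0 : ℝ), u ≠ 0 → u * deriv X u - X u = F (u ^ 2 / 2) := by
      filter_upwards [hXt.eventually hF, hGX, hconj] with u h1 h2 h3 hu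
      rw [h2] at h1
      refine mul_left_cancel₀ hu ?_
      linear_combination deriv X u * h1 + (X u + F (u ^ 2 / 2)) * h3
    filter_upwards [key, eventually_comp_neg key] with u h1 h2
    rcases eq_or_ne u 0 with rfl | hu
    · simp
    · rw [h1 hu, h2 (neg_ne_zero.2 hu), neg_sq]
  · intro h
    obtain ⟨F, hF, hFu⟩ := ((analyticAt_id.mul hX.deriv).sub hX).exists_eq_comp_sq_of_even h
    refine ⟨F, hF, ?_⟩
    have hUt : Tendsto U (𝓝 0) (𝓝 0) := by simpa [hU0] using hU.tendsto
    filter_upwards [hUt.eventually hFu, hUt.eventually hGX, hUt.eventually hconj, hXU]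
      with x h1 h2 h3 h4
    simp only [Pi.sub_apply, Pi.mul_apply, id] at h1
    rw [h4] at h1 h2 h3
    rw [h2, h1]
    linear_combination -U x * h3

theorem mainTheorem8 (g : ℝ → ℝ) (a b c : ℝ)
    (hg : AnalyticOnNhd ℝ g (Set.Icc a b))
    (hH : HypothesisH g a b c)
    (hg0 : g 0 = 0) (hg1 : deriv g 0 = 1) :
    IsIsochronousCenter (planarField g) (0, 0) ↔
      ∃ F : ℝ → ℝ, AnalyticAt ℝ F 0 ∧
        ∀ᶠ x in 𝓝 (0 : ℝ),
          2 * potential g x - x * g x = g x * F (potential g x) := by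
  have hga : AnalyticAt ℝ g 0 := hg 0 ⟨hH.a_neg.le, hH.b_pos.le⟩
  obtain ⟨X, U, hX, hU, hX0, hU0, hX1, hUX, hXU, hGX⟩ := exists_potential_chart hga hg0 hg1
  have hconj := eventually_mul_deriv_eq_of_potential_comp hga hX hX0 hGX
  obtain ⟨ρ, hρ, h⟩ := exists_isPotentialChart hga hX hX0 hX1 hUX hconj
  rw [isIsochronousCenter_iff_orbitPeriod hg0 hρ h hX0 hU.continuousAt hU0 hXU,
    exists_analyticAt_potential_iff hX hX0 hU.continuousAt hU0 hXU hGX hconj,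
    ← eventually_deriv_add_deriv_neg_iff hX hX1]
  exact ⟨fun ⟨_, hT⟩ => h.eventually_deriv_add_deriv_neg hρ hX1 hT,
    fun hE => ⟨_, h.eventually_orbitPeriod_eq hρ hE⟩⟩
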